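/- Let $n,s\ge 1$ be integers. A step up $u^k$ or a step down $d^k$ is a step $(1,1)$ or $(1,-1)$ carrying a color $k\in\{1,\dots,s\}$. An $s$-colored Dyck path of length $2n$ is a walk of $2n$ such steps from $(0,0)$ to $(2n,0)$ that never passes below the $x$-axis and in which every step up has the same color as the step down that matches it. Let $\Omega_{n,s}$ be the set of these paths. A local move exchanges a peak $u^kd^k$ with the step (up or down, of any color) immediately to its left or right, or replaces a peak $u^kd^k$ by a peak $u^{k'}d^{k'}$ with $k'\ne k$. A Fredkin Markov chain is a Markov chain on $\Omega_{n,s}$ with transition matrix $P$ that is reversible with respect to the uniform distribution and such that, for $z\neq w$, $P(z,w)>0$ if and only if $z$ and $w$ differ by a local move. Suppose $|\Omega_{n,s}|>1$, let $\lambda_0\ge\lambda_1\ge\cdots$ be the eigenvalues of $P$ with multiplicity, and let $p_{\min}(P)=\min\{P(z,w): z\ne w,\ P(z,w)\ne 0\}$. Then the spectral gap satisfies $$1-\lambda_1(P)\ \ge\ c\, s\, n^{-15/2}\, p_{\min}(P)$$ in the following two senses. 1. There is an absolute constant $c>0$ such that the bound holds for all $n,s$ with $1\le s\le n$ and $|\Omega_{n,s}|>1$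 and all Fredkin Markov chains $P$ on $\Omega_{n,s}$. In particular, for each fixed $s$ it holds for all sufficiently large $n$, with a constant that does not depend on $s$. 2. For every $s\ge 1$ there is a constant $c=c(s)>0$ such that the bound holds for all $n\ge1$ with $|\Omega_{n,s}|>1$ and all Fredkin Markov chains $P$ on $\Omega_{n,s}$. -/

import Mathlib

namespace Fredkin

/-- A colored step: `Sum.inl k` is the step up `(1,1)` of color `k`, and `Sum.inr k` is the step
down `(1,-1)` of color `k`, where `k` is one of `s` colors. -/
abbrev Step (s : ℕ) : Type := Fin s ⊕ Fin s

/-- The step up of color `k`. -/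
abbrev up {s : ℕ} (k : Fin s) : Step s := Sum.inl k

/-- The step down of color `k`. -/
abbrev down {s : ℕ} (k : Fin s) : Step s := Sum.inr k

/-- Reading a word from left to right while keeping the list of colors of the steps up that are
not yet matched, the most recent one first (so the length of this list is the current height).
A step down has to match the most recent unmatched step up and to have the same color; in
particular the walk may not pass below the axis. At the end no step up is left unmatched. -/
def Matched {s : ℕ} : List (Step s) → List (Fin s) → Prop
  | [], stack => stack = []
  | Sum.inl k :: w, stack => Matched w (k :: stack)
  | Sum.inr _ :: _, [] => False
  | Sum.inr k :: w, j :: stack => j = k ∧ Matched w stack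

/-- The `s`-colored Dyck paths from `(0,0)` to `(2n,0)`. -/
abbrev DyckPath (n s : ℕ) : Type :=
  {w : List.Vector (Step s) (2 * n) // Matched w.toList []}

noncomputable instance (n s : ℕ) : Fintype (DyckPath n s) := by
  classical exact inferInstance

/-- The local moves: a peak `u^k d^k` is exchanged with the step (up or down, of any color) to its
right or to its left, or a peak changes its color. -/
inductive Move {s : ℕ} : List (Step s) → List (Step s) → Prop
  | right (l r : List (Step s)) (k : Fin s) (x : Step s) :
      Move (l ++ [up k, down k, x] ++ r) (l ++ [x, up k, down k] ++ r)
  | left (l r : List (Step s)) (k : Fin s) (x : Step s) :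
      Move (l ++ [x, up k, down k] ++ r) (l ++ [up k, down k, x] ++ r)
  | recolor (l r : List (Step s)) (k k' : Fin s) (h : k ≠ k') :
      Move (l ++ [up k, down k] ++ r) (l ++ [up k', down k'] ++ r)

/-- `P` is the transition matrix of a Markov chain on the finite set `Ω` that is reversible with
respect to the uniform distribution. -/
structure IsReversibleUniform {Ω : Type*} [Fintype Ω] (P : Matrix Ω Ω ℝ) : Prop where
  nonneg : ∀ x y, 0 ≤ P x y
  row_sum : ∀ x, ∑ y, P x y = 1
  detailed_balance : ∀ x y,
    (Fintype.card Ω : ℝ)⁻¹ * P x y = (Fintype.card Ω : ℝ)⁻¹ * P y x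

theorem IsReversibleUniform.isHermitian {Ω : Type*} [Fintype Ω] {P : Matrix Ω Ω ℝ}
    (hP : IsReversibleUniform P) : P.IsHermitian := by
  ext x y
  have hc : (Fintype.card Ω : ℝ)⁻¹ ≠ 0 := by
    have : Nonempty Ω := ⟨x⟩
    simp
  simpa using mul_left_cancel₀ hc (hP.detailed_balance y x)

/-- The spectral gap `1 - λ₁`, where `λ₀ ≥ λ₁ ≥ ⋯` are the eigenvalues of `P`, listed with
multiplicity (Mathlib's `eigenvalues₀` is sorted in decreasing order). For `λ₁` to exist, the
state space needs more than one point. -/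
noncomputable def spectralGap {Ω : Type*} [Fintype Ω] [DecidableEq Ω] {P : Matrix Ω Ω ℝ}
    (hP : IsReversibleUniform P) (hΩ : 1 < Fintype.card Ω) : ℝ :=
  1 - hP.isHermitian.eigenvalues₀ ⟨1, hΩ⟩

/-- The smallest transition probability along an edge: the minimum of `P z w` over the pairs
`z ≠ w` with `P z w ≠ 0`. -/
noncomputable def minTransition {Ω : Type*} (P : Matrix Ω Ω ℝ) : ℝ :=
  sInf {p : ℝ | ∃ z w, z ≠ w ∧ P z w ≠ 0 ∧ P z w = p}

/-- `P` is a Fredkin Markov chain: it is reversible with respect to the uniform distribution on the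
`s`-colored Dyck paths of length `2n`, and two different paths are joined by a transition if and
only if they differ by a local move. -/
structure IsFredkinChain {n s : ℕ} (P : Matrix (DyckPath n s) (DyckPath n s) ℝ) : Prop where
  reversible : IsReversibleUniform P
  pos_iff : ∀ z w : DyckPath n s, z ≠ w → (0 < P z w ↔ Move z.1.toList w.1.toList)

end Fredkin

/-! The gap is bounded below by a Poincaré inequality (`poincare`, `le_spectralGap`). Its core is a
random removal of a peak that turns a uniform path of semilength m + 1 into a uniform path of
semilength m (`sum_prune`).

Given independent uniform paths x and y of semilength n, remove random peaks until x has semilength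
k and y has semilength n - k, and concatenate. The conditional mean of F at the result, given x and
y, is F y for k = 0 and F x for k = n, so F x - F y telescopes into n increments. One increment
compares two ways of adding a peak to a common path of semilength n - 1. By Jensen and the
invariance of uniformity, its mean square is at most that of carrying an extra peak through the
concatenation of independent uniform paths of semilengths k and n - 1 - k
(`mean_sq_interpolate_le`). The peak travels by local moves, whose total cost is controlled by
`sum_peakEnergy_le`. Replacing the weight of such a concatenation by the uniform weight on paths of
semilength n costs a factor 16 s n^(3/2), by Catalan estimates (`card_trees_le_mul`).

Altogether the gap is at least p_min / (256 s n^(11/2)). The claimed exponent leaves a spare n^(-2),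
which absorbs s^2 when s ≤ n; for fixed s the constant absorbs it. -/

namespace Fredkin

/-! ### Colored trees and the random removal of a peak -/

/-- Binary trees with colored nodes, the first-return decompositions of colored Dyck paths. -/
inductive ColoredTree (s : ℕ) : Type
  | leaf : ColoredTree s
  | node (c : Fin s) (l r : ColoredTree s) : ColoredTree s

namespace ColoredTree

variable {s : ℕ}

/-- The number of nodes. -/
def size : ColoredTree s → ℕ
  | leaf => 0
  | node _ l r => l.size + r.size + 1

/-- The Dyck word of a tree: a node of color `c` is read as `u^c l d^c r`. -/
def word : ColoredTree s → List (Step s)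
  | leaf => []
  | node c l r => up c :: (l.word ++ down c :: r.word)

theorem size_eq_zero {x : ColoredTree s} : x.size = 0 ↔ x = leaf := by
  cases x <;> simp [size]

theorem length_word (x : ColoredTree s) : x.word.length = 2 * x.size := by
  induction x with
  | leaf => rfl
  | node c l r hl hr => simp [word, size, hl, hr]; ring

open Classical in
/-- The finite set of trees with `n` nodes. -/
noncomputable def trees (s : ℕ) : ℕ → Finset (ColoredTree s)
  | 0 => {leaf}
  | n + 1 => (Finset.HasAntidiagonal.antidiagonal n).attach.biUnion fun p =>
      have := Finset.HasAntidiagonal.mem_antidiagonal.1 p.2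
      have h1 : p.1.1 < n + 1 := by omega
      have h2 : p.1.2 < n + 1 := by omega
      (Finset.univ ×ˢ (trees s p.1.1 ×ˢ trees s p.1.2)).image fun q => node q.1 q.2.1 q.2.2

theorem mem_trees {x : ColoredTree s} {n : ℕ} : x ∈ trees s n ↔ x.size = n := by
  induction x generalizing n with
  | leaf => cases n <;> simp [trees, size]
  | node c l r hl hr =>
    cases n with
    | zero => simp [trees, size]
    | succ n =>
      simp only [trees, Finset.mem_biUnion, Finset.mem_attach, true_and, Finset.mem_image,
        Finset.mem_product, Finset.mem_univ, node.injEq, Prod.exists, size]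
      constructor
      · rintro ⟨⟨p, hp⟩, c', l', r', ⟨h1, h2⟩, -, rfl, rfl⟩
        rw [hl] at h1
        rw [hr] at h2
        have := Finset.HasAntidiagonal.mem_antidiagonal.1 hp
        simp only at h1 h2
        omega
      · intro h
        refine ⟨⟨(l.size, r.size), by simp; omega⟩, c, l, r, ⟨hl.2 rfl, hr.2 rfl⟩, rfl, rfl, rfl⟩

theorem sum_trees_zero (h : ColoredTree s → ℝ) : ∑ x ∈ trees s 0, h x = h leaf := by
  simp [trees]

theorem sum_trees_succ (n : ℕ) (h : ColoredTree s → ℝ) :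
    ∑ x ∈ trees s (n + 1), h x = ∑ p ∈ Finset.HasAntidiagonal.antidiagonal n,
      ∑ c, ∑ l ∈ trees s p.1, ∑ r ∈ trees s p.2, h (node c l r) := by
  classical
  rw [trees, Finset.sum_biUnion]
  · rw [← Finset.sum_attach (Finset.HasAntidiagonal.antidiagonal n)]
    refine Finset.sum_congr rfl fun p _ => ?_
    rw [Finset.sum_image]
    · rw [Finset.sum_product]
      exact Finset.sum_congr rfl fun c _ => Finset.sum_product _ _ _
    · rintro ⟨a, b, c⟩ - ⟨a', b', c'⟩ - h
      simpa using h
  · rintro ⟨p, hp⟩ - ⟨q, hq⟩ - hpq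
    rw [Function.onFun, Finset.disjoint_left]
    simp only [Finset.mem_image, Finset.mem_product, Finset.mem_univ, true_and, mem_trees,
      Prod.exists, not_exists, not_and, forall_exists_index, and_imp]
    rintro x c l r h1 h2 rfl c' l' r' h3 h4 h5
    rw [node.injEq] at h5
    obtain ⟨-, rfl, rfl⟩ := h5
    exact hpq (Subtype.ext (Prod.ext (h1.symm.trans h3) (h2.symm.trans h4)))

/-- The probability with which the random removal of a peak from `u^c l d^c r` takes place in `l`,
where `i` and `j` are the semilengths of `l` and `r`. -/
noncomputable def pruneWeight (i j : ℕ) : ℝ :=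
  i * (i + 1) * (i + 3 * j + 2) / ((i + j) * (i + j + 1) * (i + j + 2))

theorem pruneWeight_nonneg (i j : ℕ) : 0 ≤ pruneWeight i j := by
  unfold pruneWeight; positivity

@[simp] theorem pruneWeight_zero_left (j : ℕ) : pruneWeight 0 j = 0 := by
  simp [pruneWeight]

/-- The removal takes place in exactly one of the two subtrees. For i = j = 0 both weights are 0 by
division by zero, which is why `prune` treats a single peak separately. -/
theorem pruneWeight_add (i j : ℕ) (h : i + j ≠ 0) : pruneWeight i j + pruneWeight j i = 1 := by
  have h' : (i : ℝ) + j ≠ 0 := by exact_mod_cast h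
  have h1 : (i : ℝ) + j + 1 ≠ 0 := by positivity
  have h2 : (i : ℝ) + j + 2 ≠ 0 := by positivity
  unfold pruneWeight
  rw [add_comm (j : ℝ) i]
  field_simp
  ring

/-- The quotient of the numbers of Dyck paths of semilengths `m + 1` and `m`. -/
noncomputable def growth (m : ℕ) : ℝ := (4 * m + 2) / (m + 2)

theorem growth_pos (m : ℕ) : 0 < growth m := by unfold growth; positivity

/-- This is the condition for uniformity to be preserved: subtrees of semilengths (i, j) arise by
pruning the left one of (i + 1, j) or the right one of (i, j + 1). Together with `pruneWeight_add`
and `pruneWeight_zero_left` it determines the weights recursively. -/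
theorem pruneWeight_growth (i j : ℕ) :
    pruneWeight (i + 1) j * growth i + pruneWeight (j + 1) i * growth j = growth (i + j + 1) := by
  unfold pruneWeight growth
  push_cast
  have e1 : (j : ℝ) + 1 + i = i + j + 1 := by ring
  have e2 : (i : ℝ) + 1 + j = i + j + 1 := by ring
  rw [e1, e2]
  have h0 : (i : ℝ) + j + 1 ≠ 0 := by positivity
  have h1 : (i : ℝ) + j + 1 + 1 ≠ 0 := by positivity
  have h2 : (i : ℝ) + j + 1 + 2 ≠ 0 := by positivity
  have h3 : (i : ℝ) + 2 ≠ 0 := by positivity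
  have h4 : (j : ℝ) + 2 ≠ 0 := by positivity
  field_simp
  ring

/-- The expectation over a random removal of a peak. -/
noncomputable def prune : ColoredTree s → (ColoredTree s → ℝ) →ₗ[ℝ] ℝ
  | leaf => LinearMap.proj leaf
  | node c l r =>
    if l.size + r.size = 0 then LinearMap.proj leaf
    else pruneWeight l.size r.size • (prune l ∘ₗ LinearMap.funLeft ℝ ℝ fun l' => node c l' r) +
      pruneWeight r.size l.size • (prune r ∘ₗ LinearMap.funLeft ℝ ℝ fun r' => node c l r')

theorem prune_node {c : Fin s} {l r : ColoredTree s} (h : l.size + r.size ≠ 0)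
    (f : ColoredTree s → ℝ) :
    prune (node c l r) f = pruneWeight l.size r.size * prune l (fun l' => f (node c l' r)) +
      pruneWeight r.size l.size * prune r (fun r' => f (node c l r')) := by
  rw [prune, if_neg h]
  rfl

theorem prune_node_zero {c : Fin s} {l r : ColoredTree s} (h : l.size + r.size = 0)
    (f : ColoredTree s → ℝ) : prune (node c l r) f = f leaf := by
  rw [prune, if_pos h]
  rfl

theorem prune_const (x : ColoredTree s) (a : ℝ) : prune x (fun _ => a) = a := by
  induction x with
  | leaf => rfl
  | node c l r hl hr =>
    by_cases h : l.size + r.size = 0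
    · rw [prune_node_zero h]
    · rw [prune_node h, hl, hr, ← add_mul, pruneWeight_add _ _ h, one_mul]

/-- The random removal of a peak really removes a peak. -/
theorem prune_nonneg {x : ColoredTree s} (hx : x ≠ leaf) {f : ColoredTree s → ℝ}
    (hf : ∀ y (a b : List (Step s)) (c : Fin s), x.word = a ++ [up c, down c] ++ b →
      y.word = a ++ b → 0 ≤ f y) : 0 ≤ prune x f := by
  induction x generalizing f with
  | leaf => exact absurd rfl hx
  | node c l r hl hr =>
    by_cases h : l.size + r.size = 0
    · rw [prune_node_zero h]
      obtain ⟨h1, h2⟩ := Nat.add_eq_zero_iff.1 h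
      rw [size_eq_zero] at h1 h2
      subst h1 h2
      exact hf leaf [] [] c rfl rfl
    · rw [prune_node h]
      refine add_nonneg ?_ ?_
      · by_cases h0 : l = leaf
        · subst h0
          simp [size]
        · refine mul_nonneg (pruneWeight_nonneg _ _) (hl h0 fun y a b k h1 h2 => ?_)
          refine hf _ (up c :: a) (b ++ down c :: r.word) k ?_ ?_ <;> simp [word, h1, h2]
      · by_cases h0 : r = leaf
        · subst h0
          simp [size]
        · refine mul_nonneg (pruneWeight_nonneg _ _) (hr h0 fun y a b k h1 h2 => ?_)
          refine hf _ (up c :: (l.word ++ down c :: a)) b k ?_ ?_ <;> simp [word, h1, h2]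

theorem prune_mono {x : ColoredTree s} {f g : ColoredTree s → ℝ} (h : ∀ y, f y ≤ g y) :
    prune x f ≤ prune x g := by
  by_cases hx : x = leaf
  · subst hx
    exact h leaf
  · rw [← sub_nonneg, ← map_sub]
    exact prune_nonneg hx fun y _ _ _ _ _ => sub_nonneg.2 (h y)

/-- `prune x` is a finite combination of evaluations, so it commutes with any linear functional in
another variable. -/
theorem prune_comm (x : ColoredTree s) (ψ : (ColoredTree s → ℝ) →ₗ[ℝ] ℝ)
    (F : ColoredTree s → ColoredTree s → ℝ) :
    prune x (fun a => ψ (F a)) = ψ (fun b => prune x fun a => F a b) := by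
  induction x generalizing F with
  | leaf => rfl
  | node c l r hl hr =>
    by_cases h : l.size + r.size = 0
    · simp only [prune_node_zero h]
    · simp only [prune_node h]
      rw [hl fun a => F (node c a r), hr fun a => F (node c l a), ← smul_eq_mul, ← smul_eq_mul,
        ← map_smul, ← map_smul, ← map_add]
      rfl

/-- The random removal of a peak from a uniform path gives a uniform path. -/
theorem sum_prune (m : ℕ) (f : ColoredTree s → ℝ) :
    ∑ x ∈ trees s (m + 1), prune x f = s * growth m * ∑ x ∈ trees s m, f x := by
  induction m using Nat.strong_induction_on generalizing f with
  | _ m ih =>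
  cases m with
  | zero =>
    rw [sum_trees_succ, sum_trees_zero]
    simp [sum_trees_zero, prune_node_zero, size, growth]
  | succ p =>
    have key : ∑ x ∈ trees s (p + 1 + 1), prune x f =
        (∑ q ∈ Finset.HasAntidiagonal.antidiagonal (p + 1), pruneWeight q.1 q.2 * ∑ c, ∑ r ∈ trees s q.2,
          ∑ l ∈ trees s q.1, prune l (fun l' => f (node c l' r))) +
        ∑ q ∈ Finset.HasAntidiagonal.antidiagonal (p + 1), pruneWeight q.2 q.1 * ∑ c, ∑ l ∈ trees s q.1,
          ∑ r ∈ trees s q.2, prune r (fun r' => f (node c l r')) := by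
      rw [sum_trees_succ, ← Finset.sum_add_distrib]
      refine Finset.sum_congr rfl fun q hq => ?_
      simp only [Finset.mul_sum]
      rw [← Finset.sum_add_distrib]
      refine Finset.sum_congr rfl fun c _ => ?_
      rw [Finset.sum_comm (s := trees s q.2), ← Finset.sum_add_distrib]
      refine Finset.sum_congr rfl fun l hl => ?_
      rw [← Finset.sum_add_distrib]
      refine Finset.sum_congr rfl fun r hr => ?_
      rw [mem_trees] at hl hr
      rw [prune_node, hl, hr]
      have := Finset.HasAntidiagonal.mem_antidiagonal.1 hq
      omega
    -- The boundary terms, where the subtree to be pruned is empty, have weight 0; removing them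
    -- re-indexes both sums by the sizes after the removal.
    rw [key, Finset.Nat.sum_antidiagonal_succ, Finset.Nat.sum_antidiagonal_succ']
    simp only [pruneWeight_zero_left, zero_mul, zero_add]
    rw [← Finset.sum_add_distrib, sum_trees_succ, Finset.mul_sum]
    refine Finset.sum_congr rfl fun q hq => ?_
    have hq' := Finset.HasAntidiagonal.mem_antidiagonal.1 hq
    have e1 : ∀ c r, ∑ l ∈ trees s (q.1 + 1), prune l (fun l' => f (node c l' r)) =
        s * growth q.1 * ∑ l ∈ trees s q.1, f (node c l r) := fun c r => ih _ (by omega) _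
    have e2 : ∀ c l, ∑ r ∈ trees s (q.2 + 1), prune r (fun r' => f (node c l r')) =
        s * growth q.2 * ∑ r ∈ trees s q.2, f (node c l r) := fun c l => ih _ (by omega) _
    simp only [e1, e2, ← Finset.mul_sum]
    rw [← hq', ← pruneWeight_growth,
      Finset.sum_congr rfl fun c _ => Finset.sum_comm (s := trees s q.2) (t := trees s q.1)]
    ring

theorem card_trees_succ (m : ℕ) :
    ((trees s (m + 1)).card : ℝ) = s * growth m * (trees s m).card := by
  have := sum_prune (s := s) m fun _ => 1
  simpa [prune_const] using this

end ColoredTree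
end Fredkin

/-! ### Trees and Dyck words -/

namespace Fredkin
open ColoredTree
variable {s : ℕ}

theorem matched_insert_peak (l r : List (Step s)) (c : Fin s) (st : List (Fin s)) :
    Matched (l ++ [up c, down c] ++ r) st ↔ Matched (l ++ r) st := by
  induction l generalizing st with
  | nil => simp [Matched]
  | cons a l ih =>
    rcases a with k | k
    · simpa [Matched] using ih (k :: st)
    · cases st with
      | nil => simp [Matched]
      | cons j st => simpa [Matched] using fun _ => ih st

theorem matched_word_append (x : ColoredTree s) (w : List (Step s)) (st : List (Fin s)) :
    Matched (x.word ++ w) st ↔ Matched w st := by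
  induction x generalizing w st with
  | leaf => rfl
  | node c l r hl hr => simp [word, Matched, hl, hr]

theorem matched_word (x : ColoredTree s) : Matched x.word [] := by
  simpa [Matched] using matched_word_append x [] []

/-- First-return decomposition: what precedes the step down matching the top of the stack is itself
a Dyck word. After a step up the induction is used twice, for the match of that step and then for
the match of `k`. -/
theorem Matched.exists_word_append {w : List (Step s)} {k : Fin s} {st : List (Fin s)}
    (h : Matched w (k :: st)) :
    ∃ (x : ColoredTree s) (w' : List (Step s)), w = x.word ++ down k :: w' ∧ Matched w' st := by
  induction hn : w.length using Nat.strong_induction_on generalizing w k st with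
  | _ n ih =>
  match w, h with
  | Sum.inl c :: w, h =>
    obtain ⟨l, w₁, rfl, h₁⟩ := ih w.length (by simp at hn; omega) (k := c) (st := k :: st) h rfl
    obtain ⟨r, w₂, rfl, h₂⟩ := ih w₁.length (by simp at hn; omega) h₁ rfl
    exact ⟨node c l r, w₂, by simp [word], h₂⟩
  | Sum.inr c :: w, h =>
    obtain ⟨rfl, h⟩ := h
    exact ⟨leaf, w, rfl, h⟩

theorem Matched.exists_word {w : List (Step s)} (h : Matched w []) :
    ∃ x : ColoredTree s, x.word = w := by
  induction hn : w.length using Nat.strong_induction_on generalizing w with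
  | _ n ih =>
  match w, h with
  | [], _ => exact ⟨leaf, rfl⟩
  | Sum.inl c :: w, h =>
    obtain ⟨l, w₁, rfl, h₁⟩ := Matched.exists_word_append (w := w) (k := c) (st := []) h
    obtain ⟨r, rfl⟩ := ih w₁.length (by simp at hn; omega) h₁ rfl
    exact ⟨node c l r, rfl⟩

/-- Parsing is unambiguous once the remainder cannot begin with a step up. Carrying the remainders
along makes the induction go through, since a left subtree is followed by a step down. -/
theorem word_append_inj {x y : ColoredTree s} {v w : List (Step s)}
    (hv : ∀ c t, v ≠ up c :: t) (hw : ∀ c t, w ≠ up c :: t) (h : x.word ++ v = y.word ++ w) :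
    x = y ∧ v = w := by
  induction x generalizing y v w with
  | leaf =>
    cases y with
    | leaf => exact ⟨rfl, h⟩
    | node c l r => exact absurd h (hv _ _)
  | node c l r hl hr =>
    cases y with
    | leaf => exact absurd h.symm (hw _ _)
    | node c' l' r' =>
      simp only [word, List.cons_append, List.append_assoc, List.cons.injEq, Sum.inl.injEq] at h
      obtain ⟨rfl, h⟩ := h
      obtain ⟨rfl, h₁⟩ := hl (by simp) (by simp) h
      obtain ⟨rfl, h₂⟩ := hr hv hw (List.cons.inj h₁).2
      exact ⟨rfl, h₂⟩

theorem word_injective : Function.Injective (word : ColoredTree s → List (Step s)) :=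
  fun x y h => (word_append_inj (v := []) (w := []) (by simp) (by simp) (by simpa using h)).1

/-- Functions live on all words, so that concatenation and insertion need no casts between lengths.
-/
theorem sum_trees_word (m : ℕ) (F : List (Step s) → ℝ) :
    ∑ x ∈ trees s m, F x.word = ∑ z : DyckPath m s, F z.1.toList := by
  refine Finset.sum_bij (fun x hx => ⟨⟨x.word, by rw [length_word, mem_trees.1 hx]⟩,
    matched_word x⟩) (fun _ _ => Finset.mem_univ _) ?_ ?_ fun _ _ => rfl
  · intro x _ y _ h
    exact word_injective (congrArg (fun z : DyckPath m s => z.1.toList) h)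
  · rintro ⟨⟨w, hw⟩, h⟩ -
    obtain ⟨x, rfl⟩ := Matched.exists_word h
    rw [length_word] at hw
    exact ⟨x, mem_trees.2 (by omega), rfl⟩

theorem card_trees (m : ℕ) : (trees s m).card = Fintype.card (DyckPath m s) := by
  have := sum_trees_word (s := s) m fun _ => 1
  simp only [Finset.sum_const, nsmul_eq_mul, mul_one, Finset.card_univ] at this
  exact_mod_cast this

/-- Concatenation is injective once the semilengths are fixed, and the paths that it misses
contribute nonnegatively. -/
theorem sum_trees_word_append_le (i j : ℕ) {F : List (Step s) → ℝ} (hF : ∀ w, 0 ≤ F w) :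
    ∑ x ∈ trees s i, ∑ y ∈ trees s j, F (x.word ++ y.word) ≤
      ∑ z : DyckPath (i + j) s, F z.1.toList := by
  classical
  rw [← Finset.sum_product', ← Finset.sum_attach]
  let e : {p // p ∈ trees s i ×ˢ trees s j} → DyckPath (i + j) s := fun p =>
    ⟨⟨p.1.1.word ++ p.1.2.word, by
      have h := Finset.mem_product.1 p.2
      rw [mem_trees, mem_trees] at h
      rw [List.length_append, length_word, length_word, h.1, h.2]; ring⟩,
      (matched_word_append _ _ _).2 (matched_word _)⟩
  have he : Function.Injective e := by
    rintro ⟨⟨a, b⟩, h⟩ ⟨⟨a', b'⟩, h'⟩ hab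
    have h1 : a.word ++ b.word = a'.word ++ b'.word :=
      congrArg (fun z : DyckPath (i + j) s => z.1.toList) hab
    simp only [Finset.mem_product, mem_trees] at h h'
    obtain ⟨h2, h3⟩ := List.append_inj h1 (by rw [length_word, length_word, h.1, h'.1])
    cases word_injective h2
    cases word_injective h3
    rfl
  calc _ = ∑ p : {p // p ∈ trees s i ×ˢ trees s j}, F (e p).1.toList := rfl
    _ = ∑ z ∈ Finset.univ.map ⟨e, he⟩, F z.1.toList := by rw [Finset.sum_map]; rfl
    _ ≤ _ := Finset.sum_le_sum_of_subset_of_nonneg (Finset.subset_univ _) fun _ _ _ => hF _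

/-! ### Energy of a moving peak -/

/-- Insert a peak of color `c` before the step with index `j`. -/
def insertPeak (j : ℕ) (c : Fin s) (w : List (Step s)) : List (Step s) :=
  w.take j ++ [up c, down c] ++ w.drop j

theorem insertPeak_append (l r : List (Step s)) (c : Fin s) :
    insertPeak l.length c (l ++ r) = l ++ [up c, down c] ++ r := by
  simp [insertPeak]

theorem insertPeak_inj {j : ℕ} {c c' : Fin s} {w w' : List (Step s)} (hw : w.length = w'.length)
    (h : insertPeak j c w = insertPeak j c' w') : c = c' ∧ w = w' := by
  unfold insertPeak at h
  rw [List.append_assoc, List.append_assoc] at h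
  obtain ⟨h1, h2⟩ := List.append_inj h (by simp [hw])
  obtain ⟨h3, h4⟩ := List.append_inj h2 rfl
  refine ⟨by simpa using h3, ?_⟩
  rw [← List.take_append_drop j w, h1, h4, List.take_append_drop]

/-- Insert a peak of color `c` into a Dyck path before the step with index `j`. -/
def DyckPath.insertPeak {m : ℕ} (j : ℕ) (c : Fin s) (z : DyckPath m s) : DyckPath (m + 1) s :=
  ⟨⟨Fredkin.insertPeak j c z.1.toList, by
    simp only [Fredkin.insertPeak, List.length_append, List.length_take, List.length_drop,
      List.Vector.toList_length, List.length_cons, List.length_nil]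
    omega⟩, by
    have := z.2
    rw [← List.take_append_drop j z.1.toList] at this
    exact (matched_insert_peak _ _ _ _).2 this⟩

theorem move_recolor_insertPeak (j : ℕ) {c c' : Fin s} (h : c ≠ c') (w : List (Step s)) :
    Move (insertPeak j c w) (insertPeak j c' w) :=
  Move.recolor _ _ _ _ h

theorem move_insertPeak_succ {j : ℕ} (c : Fin s) {w : List (Step s)} (hj : j < w.length) :
    Move (insertPeak j c w) (insertPeak (j + 1) c w) := by
  have := Move.right (w.take j) (w.drop (j + 1)) c w[j]
  convert this using 1
  · rw [insertPeak, ← List.cons_getElem_drop_succ (n := j) (h := hj)]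
    simp
  · rw [insertPeak, List.take_succ_eq_append_getElem hj]
    simp only [List.append_assoc, List.cons_append, List.nil_append]

open Classical in
/-- The sum of the squared increments over the local moves. -/
noncomputable def energy (n : ℕ) (F : List (Step s) → ℝ) : ℝ :=
  ∑ p : DyckPath n s × DyckPath n s,
    if Move p.1.1.toList p.2.1.toList then (F p.1.1.toList - F p.2.1.toList) ^ 2 else 0

/-- Injectivity means that each ordered pair is used at most once; diagonal pairs contribute 0. -/
theorem sum_le_energy {ι : Type*} [Fintype ι] {n : ℕ} {F : List (Step s) → ℝ}
    {e : ι → DyckPath n s × DyckPath n s} (he : Function.Injective e)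
    (hm : ∀ i, Move (e i).1.1.toList (e i).2.1.toList ∨ (e i).1 = (e i).2) :
    ∑ i, (F (e i).1.1.toList - F (e i).2.1.toList) ^ 2 ≤ energy n F := by
  classical
  calc _ ≤ ∑ i, (if Move (e i).1.1.toList (e i).2.1.toList then
        (F (e i).1.1.toList - F (e i).2.1.toList) ^ 2 else 0) := by
        refine Finset.sum_le_sum fun i _ => ?_
        split_ifs with h
        · exact le_rfl
        · simp [(hm i).resolve_left h]
    _ = ∑ p ∈ Finset.univ.map ⟨e, he⟩, (if Move p.1.1.toList p.2.1.toList then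
        (F p.1.1.toList - F p.2.1.toList) ^ 2 else 0) := by rw [Finset.sum_map]; rfl
    _ ≤ _ := by
      unfold energy
      exact Finset.sum_le_sum_of_subset_of_nonneg (Finset.subset_univ _) fun p _ _ => by
        split_ifs <;> positivity

theorem energy_nonneg (n : ℕ) (F : List (Step s) → ℝ) : 0 ≤ energy n F := by
  classical
  exact Finset.sum_nonneg fun p _ => by split_ifs <;> positivity

/-- The sum of the squared increments over the moves of an additional peak inserted into `w`. -/
noncomputable def peakEnergy (F : List (Step s) → ℝ) (w : List (Step s)) : ℝ :=
  ∑ j ∈ Finset.range (w.length + 1), ∑ c, ∑ c',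
      (F (insertPeak j c w) - F (insertPeak j c' w)) ^ 2 +
    ∑ j ∈ Finset.range w.length, ∑ c, (F (insertPeak j c w) - F (insertPeak (j + 1) c w)) ^ 2

theorem peakEnergy_nonneg (F : List (Step s) → ℝ) (w : List (Step s)) : 0 ≤ peakEnergy F w := by
  unfold peakEnergy
  positivity

/-- For a fixed position, insertion can be undone, so each of the 2m + 1 recoloring sums and 2m
exchange sums is at most the energy. -/
theorem sum_peakEnergy_le (m : ℕ) (F : List (Step s) → ℝ) :
    ∑ z : DyckPath m s, peakEnergy F z.1.toList ≤ (4 * m + 2) * energy (m + 1) F := by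
  have hl : ∀ z : DyckPath m s, z.1.toList.length = 2 * m := fun z => by simp
  have h1 : ∀ j, ∑ z : DyckPath m s, ∑ c, ∑ c', (F (insertPeak j c z.1.toList) -
      F (insertPeak j c' z.1.toList)) ^ 2 ≤ energy (m + 1) F := by
    intro j
    have := sum_le_energy (ι := DyckPath m s × Fin s × Fin s) (F := F)
      (e := fun q => (DyckPath.insertPeak j q.2.1 q.1, DyckPath.insertPeak j q.2.2 q.1))
      (by
        rintro ⟨z, c, c'⟩ ⟨w, k, k'⟩ h
        rw [Prod.mk.injEq] at h
        obtain ⟨rfl, h1⟩ := insertPeak_inj ((hl _).trans (hl _).symm)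
          (congrArg (fun z : DyckPath (m + 1) s => z.1.toList) h.1)
        obtain ⟨rfl, h2⟩ := insertPeak_inj ((hl _).trans (hl _).symm)
          (congrArg (fun z : DyckPath (m + 1) s => z.1.toList) h.2)
        cases Subtype.ext (Subtype.ext h1)
        rfl)
      (by
        rintro ⟨z, c, c'⟩
        by_cases h : c = c'
        · right; rw [h]
        · left; exact move_recolor_insertPeak j h _)
    rw [Fintype.sum_prod_type] at this
    simp only [Fintype.sum_prod_type] at this
    exact this
  have h2 : ∀ j < 2 * m, ∑ z : DyckPath m s, ∑ c, (F (insertPeak j c z.1.toList) -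
      F (insertPeak (j + 1) c z.1.toList)) ^ 2 ≤ energy (m + 1) F := by
    intro j hj
    have := sum_le_energy (ι := DyckPath m s × Fin s) (F := F)
      (e := fun q => (DyckPath.insertPeak j q.2 q.1, DyckPath.insertPeak (j + 1) q.2 q.1))
      (by
        rintro ⟨z, c⟩ ⟨w, k⟩ h
        rw [Prod.mk.injEq] at h
        obtain ⟨rfl, h1⟩ := insertPeak_inj ((hl _).trans (hl _).symm)
          (congrArg (fun z : DyckPath (m + 1) s => z.1.toList) h.1)
        cases Subtype.ext (Subtype.ext h1)
        rfl)
      (fun q => Or.inl (move_insertPeak_succ _ ((hl q.1).symm ▸ hj)))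
    simp only [Fintype.sum_prod_type] at this
    exact this
  simp only [peakEnergy, hl]
  rw [Finset.sum_add_distrib, Finset.sum_comm, Finset.sum_comm (t := Finset.range (2 * m))]
  have h3 := Finset.sum_le_sum fun j (_ : j ∈ Finset.range (2 * m + 1)) => h1 j
  have h4 := Finset.sum_le_sum fun j (h : j ∈ Finset.range (2 * m)) => h2 j (Finset.mem_range.1 h)
  rw [Finset.sum_const, Finset.card_range, nsmul_eq_mul] at h3 h4
  push_cast at h3 h4
  linarith [energy_nonneg (m + 1) F]

theorem sq_sub_le_mul_sum (u : ℕ → ℝ) {i j L : ℕ} (hi : i ≤ L) (hj : j ≤ L) :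
    (u i - u j) ^ 2 ≤ L * ∑ t ∈ Finset.range L, (u t - u (t + 1)) ^ 2 := by
  wlog h : i ≤ j generalizing i j
  · rw [← neg_sq, neg_sub]
    exact this hj hi (by omega)
  have e : u i - u j = ∑ t ∈ Finset.Ico i j, (u t - u (t + 1)) := by
    have := Finset.sum_Ico_sub u h
    rw [← neg_sub, ← this, ← Finset.sum_neg_distrib]
    simp
  have hsub : Finset.Ico i j ⊆ Finset.range L := fun t ht => by
    rw [Finset.mem_Ico] at ht
    exact Finset.mem_range.2 (by omega)
  rw [e]
  refine sq_sum_le_card_mul_sum_sq.trans ?_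
  gcongr
  simp; omega

/-- Recolor the peak at position i, then carry it to position j. With R and M the recoloring and
exchange sums and L the length, this costs 2R + 2LM ≤ 2(L + 1)(R + M). -/
theorem sq_sub_le_peakEnergy (F : List (Step s) → ℝ) (w : List (Step s)) {i j : ℕ}
    (hi : i ≤ w.length) (hj : j ≤ w.length) (c c' : Fin s) :
    (F (insertPeak i c w) - F (insertPeak j c' w)) ^ 2 ≤
      2 * (w.length + 1) * peakEnergy F w := by
  have h1 := sq_sub_le_mul_sum (fun t => F (insertPeak t c' w)) hi hj
  have h2 : (F (insertPeak i c w) - F (insertPeak i c' w)) ^ 2 ≤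
      ∑ j ∈ Finset.range (w.length + 1), ∑ c, ∑ c',
        (F (insertPeak j c w) - F (insertPeak j c' w)) ^ 2 := by
    refine le_trans ?_ (Finset.single_le_sum (fun _ _ => by positivity)
      (Finset.mem_range.2 (Nat.lt_succ_of_le hi)))
    refine le_trans ?_ (Finset.single_le_sum (fun _ _ => by positivity) (Finset.mem_univ c))
    exact Finset.single_le_sum
      (f := fun c' => (F (insertPeak i c w) - F (insertPeak i c' w)) ^ 2)
      (fun _ _ => by positivity) (Finset.mem_univ c')
  have h3 : ∑ t ∈ Finset.range w.length, (F (insertPeak t c' w) - F (insertPeak (t + 1) c' w)) ^ 2 ≤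
      ∑ j ∈ Finset.range w.length, ∑ c,
        (F (insertPeak j c w) - F (insertPeak (j + 1) c w)) ^ 2 :=
    Finset.sum_le_sum fun t _ => Finset.single_le_sum
      (f := fun c' => (F (insertPeak t c' w) - F (insertPeak (t + 1) c' w)) ^ 2)
      (fun _ _ => by positivity) (Finset.mem_univ c')
  unfold peakEnergy
  set R := ∑ j ∈ Finset.range (w.length + 1), ∑ c, ∑ c',
        (F (insertPeak j c w) - F (insertPeak j c' w)) ^ 2
  set M := ∑ j ∈ Finset.range w.length, ∑ c,
        (F (insertPeak j c w) - F (insertPeak (j + 1) c w)) ^ 2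
  have hR : 0 ≤ R := le_trans (by positivity) h2
  have hM : 0 ≤ M := le_trans (by positivity) h3
  have h4 := h1.trans (mul_le_mul_of_nonneg_left h3 (Nat.cast_nonneg _))
  have h5 : (0 : ℝ) ≤ w.length * R := by positivity
  nlinarith [sq_nonneg ((F (insertPeak i c w) - F (insertPeak i c' w)) -
    (F (insertPeak i c' w) - F (insertPeak j c' w)))]

end Fredkin

/-! ### Iterated removal of peaks -/

namespace Fredkin
open ColoredTree
variable {s : ℕ}

/-- A positive normalized functional satisfies Jensen's inequality for the square. -/
theorem sq_map_le_map_sq {α : Type*} (φ : (α → ℝ) →ₗ[ℝ] ℝ) (h1 : ∀ a : ℝ, φ (fun _ => a) = a)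
    (hpos : ∀ f : α → ℝ, (∀ x, 0 ≤ f x) → 0 ≤ φ f) (f : α → ℝ) :
    φ f ^ 2 ≤ φ fun x => f x ^ 2 := by
  have h := hpos (fun x => (f x - φ f) ^ 2) fun x => sq_nonneg _
  have e : (fun x => (f x - φ f) ^ 2) =
      (fun x => f x ^ 2) - (2 * φ f) • f + fun _ => φ f ^ 2 := by
    funext x
    simp only [Pi.add_apply, Pi.sub_apply, Pi.smul_apply, smul_eq_mul]
    ring
  rw [e, map_add, map_sub, map_smul, h1, smul_eq_mul] at h
  linarith

namespace ColoredTree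

/-- The random removal of a peak as an operator on functions. -/
noncomputable def pruneOp (s : ℕ) : Module.End ℝ (ColoredTree s → ℝ) := LinearMap.pi prune

theorem pruneOp_pow_succ (j : ℕ) (f : ColoredTree s → ℝ) :
    (pruneOp s ^ (j + 1)) f = (pruneOp s ^ j) fun x => prune x f := by
  rw [pow_succ]; rfl

theorem pruneOp_pow_const (j : ℕ) (a : ℝ) (x : ColoredTree s) :
    (pruneOp s ^ j) (fun _ => a) x = a := by
  induction j with
  | zero => rfl
  | succ j ih => simp only [pruneOp_pow_succ, prune_const, ih]

theorem pruneOp_pow_mono (j : ℕ) {f g : ColoredTree s → ℝ} (h : ∀ x, f x ≤ g x)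
    (x : ColoredTree s) : (pruneOp s ^ j) f x ≤ (pruneOp s ^ j) g x := by
  induction j generalizing f g with
  | zero => exact h x
  | succ j ih =>
    simp only [pruneOp_pow_succ]
    exact ih fun y => prune_mono h

theorem pruneOp_pow_comm (j : ℕ) (x : ColoredTree s) (ψ : (ColoredTree s → ℝ) →ₗ[ℝ] ℝ)
    (F : ColoredTree s → ColoredTree s → ℝ) :
    (pruneOp s ^ j) (fun a => ψ (F a)) x = ψ fun b => (pruneOp s ^ j) (fun a => F a b) x := by
  induction j generalizing F with
  | zero => rfl
  | succ j ih =>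
    simp only [pruneOp_pow_succ, prune_comm]
    exact ih fun a b => prune a fun a' => F a' b

theorem sq_prune_le (x : ColoredTree s) (f : ColoredTree s → ℝ) :
    prune x f ^ 2 ≤ prune x fun y => f y ^ 2 :=
  sq_map_le_map_sq _ (prune_const x) (fun g hg => by
    simpa [prune_const] using prune_mono (x := x) (f := fun _ => 0) hg) f

theorem sq_pruneOp_pow_le (j : ℕ) (x : ColoredTree s) (f : ColoredTree s → ℝ) :
    (pruneOp s ^ j) f x ^ 2 ≤ (pruneOp s ^ j) (fun y => f y ^ 2) x :=
  sq_map_le_map_sq (LinearMap.proj x ∘ₗ pruneOp s ^ j) (fun a => pruneOp_pow_const j a x)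
    (fun g hg => by
      have := pruneOp_pow_mono j (f := fun _ => 0) hg x
      rwa [pruneOp_pow_const] at this) f

theorem size_of_word {x y : ColoredTree s} {a b : List (Step s)} {c : Fin s}
    (hx : x.word = a ++ [up c, down c] ++ b) (hy : y.word = a ++ b) : x.size = y.size + 1 := by
  have h1 := length_word x
  have h2 := length_word y
  rw [hx] at h1
  rw [hy] at h2
  simp at h1 h2
  omega

/-- Removing all peaks leaves the empty path. -/
theorem pruneOp_pow_size (x : ColoredTree s) (f : ColoredTree s → ℝ) :
    (pruneOp s ^ x.size) f x = f leaf := by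
  induction hn : x.size generalizing x f with
  | zero =>
    rw [size_eq_zero] at hn
    subst hn
    rfl
  | succ n ih =>
    have hx : x ≠ leaf := fun h => by simp [h, size] at hn
    rw [pow_succ']
    change prune x ((pruneOp s ^ n) f) = f leaf
    -- By `prune_nonneg`, `prune x` only sees values at trees with one node less.
    have key : ∀ g h : ColoredTree s → ℝ, (∀ y, y.size = n → g y = h y) →
        prune x g ≤ prune x h := by
      intro g h hgh
      rw [← sub_nonneg, ← map_sub]
      refine prune_nonneg hx fun y a b c h1 h2 => ?_
      have := size_of_word h1 h2
      simp [hgh y (by omega)]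
    rw [← prune_const x (f leaf)]
    exact le_antisymm (key _ _ fun y hy => ih y f hy) (key _ _ fun y hy => (ih y f hy).symm)

/-- The mean over the trees with `m` nodes. -/
noncomputable def mean (s m : ℕ) : (ColoredTree s → ℝ) →ₗ[ℝ] ℝ :=
  ((trees s m).card : ℝ)⁻¹ • ∑ x ∈ trees s m, LinearMap.proj x

theorem mean_apply (m : ℕ) (f : ColoredTree s → ℝ) :
    mean s m f = ((trees s m).card : ℝ)⁻¹ * ∑ x ∈ trees s m, f x := by
  simp [mean]

theorem mean_mono {m : ℕ} {f g : ColoredTree s → ℝ} (h : ∀ x, x.size = m → f x ≤ g x) :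
    mean s m f ≤ mean s m g := by
  rw [mean_apply, mean_apply]
  exact mul_le_mul_of_nonneg_left (Finset.sum_le_sum fun x hx => h x (mem_trees.1 hx))
    (by positivity)

theorem card_trees_pos (hs : 0 < s) (m : ℕ) : (0 : ℝ) < (trees s m).card := by
  induction m with
  | zero => simp [trees]
  | succ m ih =>
    rw [card_trees_succ]
    have := growth_pos m
    positivity

theorem mean_prune (hs : 0 < s) (m : ℕ) (f : ColoredTree s → ℝ) :
    mean s (m + 1) (fun x => prune x f) = mean s m f := by
  rw [mean_apply, mean_apply, sum_prune, card_trees_succ]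
  have h1 := growth_pos m
  have h2 := card_trees_pos hs m
  field_simp

theorem mean_pruneOp_pow (hs : 0 < s) (m j : ℕ) (f : ColoredTree s → ℝ) :
    mean s (m + j) ((pruneOp s ^ j) f) = mean s m f := by
  induction j generalizing f with
  | zero => rfl
  | succ j ih =>
    rw [pow_succ', ← add_assoc]
    exact (mean_prune hs _ _).trans (ih f)

end ColoredTree

/-! ### Interpolation between two independent paths -/

/-- The increment of a function when a random peak is moved from `a` to `b`. -/
noncomputable def transfer (F : List (Step s) → ℝ) (a b : ColoredTree s) : ℝ :=
  prune b (fun b' => F (a.word ++ b'.word)) - prune a fun a' => F (a'.word ++ b.word)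

/-- Both `a.word ++ b'.word` and `a'.word ++ b.word` are `a'.word ++ b'.word` with one peak
inserted. Jensen is applied in each variable. -/
theorem sq_transfer_le (F : List (Step s) → ℝ) {a b : ColoredTree s} (ha : a ≠ leaf)
    (hb : b ≠ leaf) :
    transfer F a b ^ 2 ≤ prune a fun a' => prune b fun b' =>
      2 * ((a'.word ++ b'.word).length + 1) * peakEnergy F (a'.word ++ b'.word) := by
  have e : transfer F a b = prune a fun a' => prune b fun b' =>
      F (a.word ++ b'.word) - F (a'.word ++ b.word) := by
    have h1 : ∀ a' : ColoredTree s, (prune b fun b' => F (a.word ++ b'.word) - F (a'.word ++ b.word))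
        = prune b (fun b' => F (a.word ++ b'.word)) - F (a'.word ++ b.word) := fun a' => by
      rw [← prune_const b (F (a'.word ++ b.word)), ← map_sub, prune_const]
      rfl
    simp only [h1]
    rw [transfer]
    conv_lhs => rw [← prune_const a (prune b fun b' => F (a.word ++ b'.word))]
    rw [← map_sub]
    rfl
  rw [e]
  refine (sq_prune_le _ _).trans ((prune_mono fun a' => sq_prune_le _ _).trans ?_)
  rw [← sub_nonneg, ← map_sub]
  refine prune_nonneg ha fun a' l r c h1 h2 => ?_
  rw [Pi.sub_apply, ← map_sub]
  refine prune_nonneg hb fun b' l' r' c' h3 h4 => sub_nonneg.2 ?_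
  have e1 : a.word ++ b'.word = insertPeak l.length c (a'.word ++ b'.word) := by
    rw [h1, h2, List.append_assoc l r, insertPeak_append]
    simp
  have e2 : a'.word ++ b.word = insertPeak (a'.word ++ l').length c' (a'.word ++ b'.word) := by
    rw [h3, h4, ← List.append_assoc a'.word l', insertPeak_append]
    simp
  beta_reduce
  rw [e1, e2]
  refine sq_sub_le_peakEnergy F _ ?_ ?_ c c'
  · rw [h2]; simp
  · rw [h4]; simp

/-- The function that interpolates between `(x, y) ↦ F y` and `(x, y) ↦ F x`: all but `k` peaks of
`x` and `k` peaks of `y` are removed. -/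
noncomputable def interpolate (F : List (Step s) → ℝ) (n k : ℕ) (x y : ColoredTree s) : ℝ :=
  (pruneOp s ^ (n - k)) (fun a => (pruneOp s ^ k) (fun b => F (a.word ++ b.word)) y) x

theorem interpolate_zero (F : List (Step s) → ℝ) {n : ℕ} {x y : ColoredTree s} (hx : x.size = n) :
    interpolate F n 0 x y = F y.word := by
  subst hx
  exact pruneOp_pow_size x _

theorem interpolate_self (F : List (Step s) → ℝ) {n : ℕ} {x y : ColoredTree s} (hy : y.size = n) :
    interpolate F n n x y = F x.word := by
  subst hy
  unfold interpolate
  rw [Nat.sub_self]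
  change (pruneOp s ^ y.size) (fun b => F (x.word ++ b.word)) y = _
  rw [pruneOp_pow_size]
  simp [word]

/-- The two terms share i removals from x and k from y; they differ only in whether the last removal
is made in y or in x. -/
theorem interpolate_succ_sub (F : List (Step s) → ℝ) {n k i : ℕ} (h : n = k + i + 1)
    (x y : ColoredTree s) :
    interpolate F n (k + 1) x y - interpolate F n k x y =
      (pruneOp s ^ i) (fun a => (pruneOp s ^ k) (transfer F a) y) x := by
  subst h
  unfold interpolate
  rw [show k + i + 1 - (k + 1) = i by omega, show k + i + 1 - k = i + 1 by omega, pruneOp_pow_succ]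
  have h2 : ∀ a : ColoredTree s,
      (prune a fun a' => (pruneOp s ^ k) (fun b => F (a'.word ++ b.word)) y) =
      (pruneOp s ^ k) (fun b => prune a fun a' => F (a'.word ++ b.word)) y := fun a =>
    prune_comm a (LinearMap.proj y ∘ₗ pruneOp s ^ k) fun a' b => F (a'.word ++ b.word)
  simp only [h2, pruneOp_pow_succ]
  rw [← Pi.sub_apply, ← map_sub]
  refine congrArg (fun f => (pruneOp s ^ i) f x) (funext fun a => ?_)
  rw [Pi.sub_apply, ← Pi.sub_apply, ← map_sub]
  rfl

/-- Jensen moves the square inside the removals, and the means then swallow the removals because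
these preserve uniformity. -/
theorem mean_sq_interpolate_le (hs : 0 < s) (F : List (Step s) → ℝ) {n k i : ℕ}
    (h : n = k + i + 1) :
    mean s n (fun x => mean s n fun y =>
      (interpolate F n (k + 1) x y - interpolate F n k x y) ^ 2) ≤
    mean s k fun a => mean s i fun b =>
      2 * ((a.word ++ b.word).length + 1) * peakEnergy F (a.word ++ b.word) := by
  calc _ ≤ mean s n (fun x => mean s n fun y =>
        (pruneOp s ^ i) (fun a => (pruneOp s ^ k) (fun b => transfer F a b ^ 2) y) x) := by
        refine mean_mono fun x _ => mean_mono fun y _ => ?_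
        rw [interpolate_succ_sub F h]
        exact (sq_pruneOp_pow_le _ _ _).trans
          (pruneOp_pow_mono _ (fun a => sq_pruneOp_pow_le _ _ _) _)
    _ = mean s n ((pruneOp s ^ i) fun a => mean s n ((pruneOp s ^ k) fun b => transfer F a b ^ 2)) := by
        congr 1
        funext x
        exact (pruneOp_pow_comm i x (mean s n)
          fun a => (pruneOp s ^ k) fun b => transfer F a b ^ 2).symm
    _ = mean s (k + 1) fun a => mean s (i + 1) fun b => transfer F a b ^ 2 := by
        rw [show n = k + 1 + i by omega, mean_pruneOp_pow hs]
        congr 1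
        funext a
        rw [show k + 1 + i = i + 1 + k by omega, mean_pruneOp_pow hs]
    _ ≤ mean s (k + 1) fun a => mean s (i + 1) fun b => prune a fun a' => prune b fun b' =>
          2 * ((a'.word ++ b'.word).length + 1) * peakEnergy F (a'.word ++ b'.word) := by
        refine mean_mono fun a ha => mean_mono fun b hb => sq_transfer_le F ?_ ?_
        · rintro rfl; simp [size] at ha
        · rintro rfl; simp [size] at hb
    _ = _ := by
        rw [← mean_prune hs k]
        congr 1
        funext a
        rw [← prune_comm a (mean s (i + 1)) fun a' b => prune b fun b' =>
          2 * ((a'.word ++ b'.word).length + 1) * peakEnergy F (a'.word ++ b'.word)]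
        simp only [mean_prune hs]

theorem mean_sq_sub_le (hs : 0 < s) (F : List (Step s) → ℝ) (n : ℕ) :
    mean s n (fun x => mean s n fun y => (F x.word - F y.word) ^ 2) ≤
      n * ∑ k ∈ Finset.range n, mean s k fun a => mean s (n - 1 - k) fun b =>
        2 * ((a.word ++ b.word).length + 1) * peakEnergy F (a.word ++ b.word) := by
  calc _ ≤ mean s n (fun x => mean s n fun y => n * ∑ k ∈ Finset.range n,
        (interpolate F n (k + 1) x y - interpolate F n k x y) ^ 2) := by
        refine mean_mono fun x hx => mean_mono fun y hy => ?_
        have h := Finset.sum_range_sub (fun k => interpolate F n k x y) n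
        rw [interpolate_zero F hx, interpolate_self F hy] at h
        rw [← h]
        simpa using sq_sum_le_card_mul_sum_sq (s := Finset.range n)
          (f := fun k => interpolate F n (k + 1) x y - interpolate F n k x y)
    _ = n * ∑ k ∈ Finset.range n, mean s n (fun x => mean s n fun y =>
        (interpolate F n (k + 1) x y - interpolate F n k x y) ^ 2) := by
        simp only [mean_apply, Finset.mul_sum]
        rw [Finset.sum_congr rfl fun x _ => Finset.sum_comm, Finset.sum_comm]
        exact Finset.sum_congr rfl fun _ _ => Finset.sum_congr rfl fun _ _ =>
          Finset.sum_congr rfl fun _ _ => by ring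
    _ ≤ _ := by
        gcongr with k hk
        rw [Finset.mem_range] at hk
        exact mean_sq_interpolate_le hs F (by omega)

end Fredkin

/-! ### Catalan estimates and the Poincaré inequality -/

namespace Fredkin
open ColoredTree
variable {s : ℕ}

/-- The count is of order (4s)^m m^(-3/2). Squaring avoids half-integer powers, and for s > 0 the
ratio of the two sides is monotone in m. -/
theorem sq_card_trees_le (m : ℕ) :
    ((trees s m).card : ℝ) ^ 2 * (m + 1) ^ 3 ≤ (16 * (s : ℝ) ^ 2) ^ m := by
  induction m with
  | zero => simp [trees]
  | succ m ih =>
    rw [card_trees_succ, pow_succ]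
    push_cast
    have h : growth m ^ 2 * (m + 1 + 1) ^ 3 ≤ 16 * ((m : ℝ) + 1) ^ 3 := by
      unfold growth
      rw [div_pow, div_mul_eq_mul_div, div_le_iff₀ (by positivity)]
      have : (0 : ℝ) ≤ m := Nat.cast_nonneg m
      have : 0 ≤ (m : ℝ) ^ 2 := by positivity
      have : 0 ≤ (m : ℝ) ^ 3 := by positivity
      have : 0 ≤ (m : ℝ) ^ 4 := by positivity
      have : 0 ≤ (m : ℝ) ^ 5 := by positivity
      nlinarith
    calc _ = (s : ℝ) ^ 2 * (trees s m).card ^ 2 * (growth m ^ 2 * (m + 1 + 1) ^ 3) := by ring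
      _ ≤ (s : ℝ) ^ 2 * (trees s m).card ^ 2 * (16 * ((m : ℝ) + 1) ^ 3) := by gcongr
      _ = ((trees s m).card ^ 2 * (m + 1) ^ 3) * (16 * (s : ℝ) ^ 2) := by ring
      _ ≤ _ := mul_le_mul_of_nonneg_right ih (by positivity)

theorem le_sq_card_trees (m : ℕ) :
    (16 * (s : ℝ) ^ 2) ^ m ≤ 4 * ((trees s m).card : ℝ) ^ 2 * (m + 1) ^ 3 := by
  -- The factor (m + 1)^3 makes the ratio monotone in the wrong direction for a lower bound; m (m +
  -- 1)^2 reverses this. It vanishes at 0, so the induction starts at 1, where equality holds and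
  -- fixes the constant 4.
  have key : ∀ m : ℕ, (16 * (s : ℝ) ^ 2) ^ (m + 1) ≤
      4 * ((trees s (m + 1)).card : ℝ) ^ 2 * ((m + 1) * (m + 2) ^ 2) := by
    intro m
    induction m with
    | zero =>
      rw [card_trees_succ]
      simp [trees, growth]
      linarith
    | succ m ih =>
      rw [card_trees_succ, pow_succ]
      push_cast
      have h : 16 * (((m : ℝ) + 1) * (m + 2) ^ 2) ≤
          growth (m + 1) ^ 2 * ((m + 1 + 1) * (m + 1 + 2) ^ 2) := by
        unfold growth
        rw [div_pow, div_mul_eq_mul_div, le_div_iff₀ (by positivity)]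
        push_cast
        have : (0 : ℝ) ≤ m := Nat.cast_nonneg m
        have e : (4 * ((m : ℝ) + 1) + 2) ^ 2 * ((m + 1 + 1) * (m + 1 + 2) ^ 2) -
          16 * ((m + 1) * (m + 2) ^ 2) * (m + 1 + 2) ^ 2 = 4 * (m + 2) * (m + 3) ^ 2 := by ring
        nlinarith [show 0 ≤ 4 * ((m : ℝ) + 2) * (m + 3) ^ 2 by positivity]
      calc _ ≤ 4 * ((trees s (m + 1)).card : ℝ) ^ 2 * ((m + 1) * (m + 2) ^ 2) *
            (16 * (s : ℝ) ^ 2) := by gcongr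
        _ = 4 * (s : ℝ) ^ 2 * (trees s (m + 1)).card ^ 2 *
            (16 * ((m + 1) * (m + 2) ^ 2)) := by ring
        _ ≤ 4 * (s : ℝ) ^ 2 * (trees s (m + 1)).card ^ 2 *
            (growth (m + 1) ^ 2 * ((m + 1 + 1) * (m + 1 + 2) ^ 2)) := by gcongr
        _ = _ := by ring
  cases m with
  | zero => simp [trees]
  | succ m =>
    refine (key m).trans ?_
    push_cast
    gcongr
    nlinarith [show (0 : ℝ) ≤ m from Nat.cast_nonneg m, show (0 : ℝ) ≤ (m : ℝ) ^ 2 by positivity]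

theorem card_trees_le_mul {n k i : ℕ} (h : n = k + i + 1) :
    ((trees s n).card : ℝ) ≤
      16 * s * (n : ℝ) ^ (3 / 2 : ℝ) * (trees s k).card * (trees s i).card := by
  have hn : (n : ℝ) = k + i + 1 := by rw [h]; push_cast; ring
  have hr : ((n : ℝ) ^ (3 / 2 : ℝ)) ^ 2 = (n : ℝ) ^ 3 := by
    rw [← Real.rpow_natCast, ← Real.rpow_mul (Nat.cast_nonneg n), ← Real.rpow_natCast]
    norm_num
  refine le_of_sq_le_sq ?_ (by positivity)
  have h1 := sq_card_trees_le (s := s) n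
  have h2 := le_sq_card_trees (s := s) k
  have h3 := le_sq_card_trees (s := s) i
  have h4 : ((k : ℝ) + 1) ^ 3 ≤ n ^ 3 := by
    gcongr; linarith [show (0 : ℝ) ≤ i from Nat.cast_nonneg i]
  have h5 : ((i : ℝ) + 1) ^ 3 ≤ (n + 1) ^ 3 := by
    gcongr; linarith [show (0 : ℝ) ≤ k from Nat.cast_nonneg k]
  -- The bound for i is deliberately weakened to n + 1, so that its cube cancels the one in `h1`.
  -- The constant is 4 · 4 · 16 = 16^2.
  have h6 : (0 : ℝ) < (n + 1) ^ 3 := by positivity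
  refine le_of_mul_le_mul_right ?_ h6
  calc _ ≤ (16 * (s : ℝ) ^ 2) ^ n := h1
    _ = (16 * (s : ℝ) ^ 2) ^ k * (16 * (s : ℝ) ^ 2) ^ i * (16 * (s : ℝ) ^ 2) := by
      rw [h]; ring
    _ ≤ (4 * ((trees s k).card : ℝ) ^ 2 * n ^ 3) * (4 * ((trees s i).card : ℝ) ^ 2 * (n + 1) ^ 3) *
        (16 * (s : ℝ) ^ 2) := by
      gcongr
      · exact h2.trans (by gcongr)
      · exact h3.trans (by gcongr)
    _ = _ := by
      rw [mul_pow, mul_pow, mul_pow, mul_pow, hr]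
      ring

/-- The constant collects n from Cauchy–Schwarz, n values of k, 2(2n - 1)(4n - 2) ≤ 16 n^2 from the
moving peak, and 16 s n^(3/2) from the change of measure. -/
theorem poincare (hs : 0 < s) {n : ℕ} (hn : 0 < n) (F : List (Step s) → ℝ) :
    ∑ z : DyckPath n s, ∑ w : DyckPath n s, (F z.1.toList - F w.1.toList) ^ 2 ≤
      256 * s * (n : ℝ) ^ 4 * (n : ℝ) ^ (3 / 2 : ℝ) *
        (Fintype.card (DyckPath n s) * energy n F) := by
  obtain ⟨m, rfl⟩ : ∃ m, n = m + 1 := ⟨n - 1, by omega⟩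
  set r := ((m + 1 : ℕ) : ℝ) ^ (3 / 2 : ℝ) with hr
  have hr0 : 0 ≤ r := by positivity
  have hN := card_trees_pos hs (m + 1)
  have hE := energy_nonneg (m + 1) F
  have hm : ((m + 1 : ℕ) : ℝ) = m + 1 := by push_cast; rfl
  set N := ((trees s (m + 1)).card : ℝ) with hNdef
  have key : ∀ k ∈ Finset.range (m + 1), (mean s k fun a => mean s (m + 1 - 1 - k) fun b =>
      2 * ((a.word ++ b.word).length + 1) * peakEnergy F (a.word ++ b.word)) ≤
      256 * s * r * (m + 1) ^ 2 * energy (m + 1) F * N⁻¹ := by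
    intro k hk
    rw [Finset.mem_range] at hk
    obtain ⟨i, rfl⟩ : ∃ i, m = k + i := ⟨m - k, by omega⟩
    rw [show k + i + 1 - 1 - k = i by omega]
    have h1 := sum_trees_word_append_le (s := s) k i (peakEnergy_nonneg F)
    have h2 := h1.trans (sum_peakEnergy_le (k + i) F)
    have h3 : (mean s k fun a => mean s i fun b =>
        2 * ((a.word ++ b.word).length + 1) * peakEnergy F (a.word ++ b.word)) =
        2 * (2 * (k + i : ℕ) + 1) * ((((trees s k).card : ℝ) * (trees s i).card)⁻¹ *
        ∑ x ∈ trees s k, ∑ y ∈ trees s i, peakEnergy F (x.word ++ y.word)) := by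
      simp only [mean_apply, Finset.mul_sum]
      refine Finset.sum_congr rfl fun x hx => Finset.sum_congr rfl fun y hy => ?_
      rw [List.length_append, length_word, length_word, mem_trees.1 hx, mem_trees.1 hy, mul_inv]
      push_cast
      ring
    rw [h3]
    have hk := card_trees_pos hs k
    have hi := card_trees_pos hs i
    have h4 : (((trees s k).card : ℝ) * (trees s i).card)⁻¹ ≤ 16 * s * r * N⁻¹ := by
      rw [inv_le_iff_one_le_mul₀ (by positivity)]
      have := card_trees_le_mul (s := s) (n := k + i + 1) rfl
      rw [← hr, ← hNdef] at this
      calc (1 : ℝ) = N * N⁻¹ := (mul_inv_cancel₀ hN.ne').symm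
        _ ≤ (16 * s * r * (trees s k).card * (trees s i).card) * N⁻¹ := by gcongr
        _ = _ := by ring
    have h0 : 0 ≤ ∑ x ∈ trees s k, ∑ y ∈ trees s i, peakEnergy F (x.word ++ y.word) :=
      Finset.sum_nonneg fun _ _ => Finset.sum_nonneg fun _ _ => peakEnergy_nonneg _ _
    have h5 := mul_le_mul h4 h2 h0 (by positivity)
    refine (mul_le_mul_of_nonneg_left h5 (by positivity)).trans ?_
    have h6 : 2 * (2 * ((k + i : ℕ) : ℝ) + 1) * (4 * ((k + i : ℕ) : ℝ) + 2) ≤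
        16 * (((k + i : ℕ) : ℝ) + 1) ^ 2 := by
      nlinarith [show (0 : ℝ) ≤ ((k + i : ℕ) : ℝ) from Nat.cast_nonneg _]
    calc _ = 16 * s * r * N⁻¹ * energy (k + i + 1) F *
          (2 * (2 * ((k + i : ℕ) : ℝ) + 1) * (4 * ((k + i : ℕ) : ℝ) + 2)) := by ring
      _ ≤ 16 * s * r * N⁻¹ * energy (k + i + 1) F * (16 * (((k + i : ℕ) : ℝ) + 1) ^ 2) := by gcongr
      _ = _ := by ring
  have h1 := (mean_sq_sub_le hs F (m + 1)).trans
    (mul_le_mul_of_nonneg_left (Finset.sum_le_sum key) (Nat.cast_nonneg _))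
  have h2 : (mean s (m + 1) fun x => mean s (m + 1) fun y => (F x.word - F y.word) ^ 2) =
      (N ^ 2)⁻¹ * ∑ z : DyckPath (m + 1) s, ∑ w : DyckPath (m + 1) s,
        (F z.1.toList - F w.1.toList) ^ 2 := by
    rw [← sum_trees_word (m + 1) fun v => ∑ w : DyckPath (m + 1) s, (F v - F w.1.toList) ^ 2]
    have h3 : ∀ x : ColoredTree s, ∑ w : DyckPath (m + 1) s, (F x.word - F w.1.toList) ^ 2 =
        ∑ y ∈ trees s (m + 1), (F x.word - F y.word) ^ 2 := fun x =>
      (sum_trees_word (m + 1) fun v => (F x.word - F v) ^ 2).symm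
    simp only [h3, mean_apply, Finset.mul_sum]
    exact Finset.sum_congr rfl fun _ _ => Finset.sum_congr rfl fun _ _ => by
      rw [sq N, mul_inv]; ring
  rw [h2, Finset.sum_const, Finset.card_range, nsmul_eq_mul, inv_mul_le_iff₀ (by positivity)] at h1
  refine h1.trans_eq ?_
  rw [← card_trees, ← hNdef, hm]
  field_simp

end Fredkin

/-! ### From the Poincaré inequality to the spectral gap -/

namespace Fredkin

/-- A Poincaré inequality bounds the spectral gap from below. -/
theorem le_spectralGap {Ω : Type*} [Fintype Ω] [DecidableEq Ω] {P : Matrix Ω Ω ℝ}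
    (hP : IsReversibleUniform P) (hΩ : 1 < Fintype.card Ω) {κ : ℝ}
    (h : ∀ f : Ω → ℝ, κ * ∑ x, ∑ y, (f x - f y) ^ 2 ≤
      Fintype.card Ω * ∑ x, ∑ y, P x y * (f x - f y) ^ 2) : κ ≤ spectralGap hP hΩ := by
  have hH := hP.isHermitian
  let e : Fin (Fintype.card Ω) ≃ Ω := Fintype.equivOfCardEq (Fintype.card_fin _)
  let i₀ : Fin (Fintype.card Ω) := ⟨0, by omega⟩
  let i₁ : Fin (Fintype.card Ω) := ⟨1, hΩ⟩
  let v : Ω → ℝ := hH.eigenvectorBasis (e i₀)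
  let w : Ω → ℝ := hH.eigenvectorBasis (e i₁)
  set l₀ := hH.eigenvalues₀ i₀
  set l₁ := hH.eigenvalues₀ i₁
  have hl : l₁ ≤ l₀ := hH.eigenvalues₀_antitone (by simp [i₀, i₁, Fin.le_def])
  have hev : ∀ i, hH.eigenvalues (e i) = hH.eigenvalues₀ i := fun i => by
    simp [Matrix.IsHermitian.eigenvalues, e]
  have hv : ∀ x, ∑ y, P x y * v y = l₀ * v x := fun x => by
    have := congrFun (hH.mulVec_eigenvectorBasis (e i₀)) x
    rw [hev] at this
    exact this
  have hw : ∀ x, ∑ y, P x y * w y = l₁ * w x := fun x => by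
    have := congrFun (hH.mulVec_eigenvectorBasis (e i₁)) x
    rw [hev] at this
    exact this
  have inner_eq : ∀ i j : Fin (Fintype.card Ω),
      ∑ x, hH.eigenvectorBasis (e i) x * hH.eigenvectorBasis (e j) x = if i = j then 1 else 0 := by
    intro i j
    have := orthonormal_iff_ite.1 hH.eigenvectorBasis.orthonormal (e i) (e j)
    rw [PiLp.inner_apply] at this
    simpa [mul_comm] using this
  have hvv : ∑ x, v x * v x = 1 := by simpa using inner_eq i₀ i₀
  have hww : ∑ x, w x * w x = 1 := by simpa using inner_eq i₁ i₁
  have hvw : ∑ x, v x * w x = 0 := by simpa [i₀, i₁] using inner_eq i₀ i₁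
  -- The span of the top two eigenvectors contains a nonzero function of sum zero. Hence the top
  -- eigenvector need not be identified with the constants.
  obtain ⟨α, β, hαβ, h0⟩ : ∃ α β : ℝ, 0 < α ^ 2 + β ^ 2 ∧ α * ∑ x, v x + β * ∑ x, w x = 0 := by
    by_cases h1 : ∑ x, v x = 0
    · exact ⟨1, 0, by norm_num, by simp [h1]⟩
    · exact ⟨∑ x, w x, -∑ x, v x, by
        have : 0 < (-∑ x, v x) ^ 2 := by rw [neg_sq]; exact sq_pos_of_ne_zero h1
        positivity, by ring⟩
  let f : Ω → ℝ := fun x => α * v x + β * w x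
  have hsum : ∑ x, f x = 0 := by
    simpa [f, Finset.sum_add_distrib, Finset.mul_sum] using h0
  have hnorm : ∑ x, f x ^ 2 = α ^ 2 + β ^ 2 := by
    have : ∀ x, f x ^ 2 = α ^ 2 * (v x * v x) + β ^ 2 * (w x * w x) +
        2 * α * β * (v x * w x) := fun x => by simp only [f]; ring
    simp only [this, Finset.sum_add_distrib, ← Finset.mul_sum, hvv, hww, hvw]
    ring
  have hquad : ∑ x, f x * ∑ y, P x y * f y = l₀ * α ^ 2 + l₁ * β ^ 2 := by
    have h1 : ∀ x, ∑ y, P x y * f y = α * (l₀ * v x) + β * (l₁ * w x) := fun x => by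
      rw [← hv, ← hw, Finset.mul_sum, Finset.mul_sum, ← Finset.sum_add_distrib]
      exact Finset.sum_congr rfl fun y _ => by simp only [f]; ring
    have h2 : ∀ x, f x * ∑ y, P x y * f y = l₀ * α ^ 2 * (v x * v x) + l₁ * β ^ 2 * (w x * w x) +
        (l₀ + l₁) * α * β * (v x * w x) := fun x => by rw [h1]; simp only [f]; ring
    simp only [h2, Finset.sum_add_distrib, ← Finset.mul_sum, hvv, hww, hvw]
    ring
  have hvar : ∑ x, ∑ y, (f x - f y) ^ 2 = 2 * Fintype.card Ω * (α ^ 2 + β ^ 2) := by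
    have h1 : ∀ x y, (f x - f y) ^ 2 = f x ^ 2 + f y ^ 2 - 2 * (f x * f y) := fun x y => by ring
    simp only [h1, Finset.sum_sub_distrib, Finset.sum_add_distrib, ← Finset.mul_sum, hsum, hnorm,
      Finset.sum_const, Finset.card_univ, nsmul_eq_mul, mul_zero]
    ring
  have hsymm : ∀ x y, P x y = P y x := fun x y => by simpa using hH.apply y x
  have hdir : ∑ x, ∑ y, P x y * (f x - f y) ^ 2 =
      2 * ((1 - l₀) * α ^ 2 + (1 - l₁) * β ^ 2) := by
    have h1 : ∀ x y, P x y * (f x - f y) ^ 2 = P x y * f x ^ 2 + P x y * f y ^ 2 -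
        2 * (f x * (P x y * f y)) := fun x y => by ring
    have h2 : ∑ x, ∑ y, P x y * f x ^ 2 = α ^ 2 + β ^ 2 := by
      simp only [← Finset.sum_mul, hP.row_sum, one_mul, hnorm]
    have h3 : ∑ x, ∑ y, P x y * f y ^ 2 = α ^ 2 + β ^ 2 := by
      rw [Finset.sum_comm, ← h2]
      exact Finset.sum_congr rfl fun x _ => Finset.sum_congr rfl fun y _ => by rw [hsymm]
    simp only [h1, Finset.sum_sub_distrib, Finset.sum_add_distrib, h2, h3]
    simp only [← Finset.mul_sum, hquad]
    ring
  have key := h f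
  rw [hvar, hdir] at key
  have hN : (0 : ℝ) < Fintype.card Ω := by exact_mod_cast (by omega : 0 < Fintype.card Ω)
  change κ ≤ 1 - l₁
  have h1 : (1 - l₀) * α ^ 2 ≤ (1 - l₁) * α ^ 2 := by gcongr
  have h2 : 2 * Fintype.card Ω * (α ^ 2 + β ^ 2) * κ ≤
      2 * Fintype.card Ω * (α ^ 2 + β ^ 2) * (1 - l₁) := by
    have := mul_le_mul_of_nonneg_left h1 hN.le
    linarith
  exact le_of_mul_le_mul_left h2 (by positivity)

theorem minTransition_le {Ω : Type*} {P : Matrix Ω Ω ℝ} (h0 : ∀ x y, 0 ≤ P x y) {x y : Ω}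
    (hxy : x ≠ y) (hP : P x y ≠ 0) : minTransition P ≤ P x y :=
  csInf_le ⟨0, by rintro _ ⟨z, w, -, -, rfl⟩; exact h0 z w⟩ ⟨x, y, hxy, hP, rfl⟩

theorem minTransition_nonneg {Ω : Type*} {P : Matrix Ω Ω ℝ} (h0 : ∀ x y, 0 ≤ P x y) :
    0 ≤ minTransition P :=
  Real.sInf_nonneg (by rintro _ ⟨z, w, -, -, rfl⟩; exact h0 z w)

theorem pos_of_one_lt_card {n s : ℕ} (hΩ : 1 < Fintype.card (DyckPath n s)) : 0 < s ∧ 0 < n := by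
  rw [← card_trees] at hΩ
  rcases n with _ | n
  · simp [ColoredTree.trees] at hΩ
  · refine ⟨Nat.pos_of_ne_zero ?_, n.succ_pos⟩
    rintro rfl
    have h : ((ColoredTree.trees 0 (n + 1)).card : ℝ) = 0 := by
      rw [ColoredTree.card_trees_succ]; simp
    rw [Nat.cast_eq_zero] at h
    omega

theorem mul_minTransition_le_spectralGap {n s : ℕ} (hΩ : 1 < Fintype.card (DyckPath n s))
    {P : Matrix (DyckPath n s) (DyckPath n s) ℝ} (hP : IsFredkinChain P) {κ : ℝ} (hκ : 0 ≤ κ)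
    (h : κ * (256 * s * (n : ℝ) ^ 4 * (n : ℝ) ^ (3 / 2 : ℝ)) ≤ 1) :
    κ * minTransition P ≤ spectralGap hP.reversible hΩ := by
  classical
  obtain ⟨hs, hn⟩ := pos_of_one_lt_card hΩ
  refine le_spectralGap hP.reversible hΩ fun f => ?_
  -- Extension by 0 to words that are not paths.
  let F : List (Step s) → ℝ := fun w =>
    if hw : w.length = 2 * n ∧ Matched w [] then f ⟨⟨w, hw.1⟩, hw.2⟩ else 0
  have hF : ∀ z : DyckPath n s, F z.1.toList = f z := fun z =>
    dif_pos ⟨z.1.toList_length, z.2⟩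
  have hp := minTransition_nonneg hP.reversible.nonneg
  have h1 := poincare hs hn F
  simp only [hF] at h1
  have hE := energy_nonneg n F
  have h2 : minTransition P * energy n F ≤ ∑ x, ∑ y, P x y * (f x - f y) ^ 2 := by
    rw [energy, Fintype.sum_prod_type, Finset.mul_sum]
    refine Finset.sum_le_sum fun x _ => ?_
    rw [Finset.mul_sum]
    refine Finset.sum_le_sum fun y _ => ?_
    simp only [hF]
    have h0 := hP.reversible.nonneg x y
    split_ifs with hm
    · by_cases hxy : x = y
      · simp [hxy]
      · have := minTransition_le hP.reversible.nonneg hxy ((hP.pos_iff x y hxy).2 hm).ne'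
        gcongr
    · rw [mul_zero]
      positivity
  calc _ ≤ κ * minTransition P * _ := mul_le_mul_of_nonneg_left h1 (by positivity)
    _ = κ * (256 * s * (n : ℝ) ^ 4 * (n : ℝ) ^ (3 / 2 : ℝ)) *
        (Fintype.card (DyckPath n s) * (minTransition P * energy n F)) := by ring
    _ ≤ 1 * (Fintype.card (DyckPath n s) * (minTransition P * energy n F)) := by gcongr
    _ ≤ _ := by rw [one_mul]; gcongr

theorem rpow_mul_pow_mul_rpow {n : ℕ} (hn : 0 < n) :
    (n : ℝ) ^ (-(15 / 2 : ℝ)) * ((n : ℝ) ^ 4 * (n : ℝ) ^ (3 / 2 : ℝ)) = ((n : ℝ) ^ 2)⁻¹ := by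
  have h : (0 : ℝ) < n := by exact_mod_cast hn
  rw [← Real.rpow_natCast, ← Real.rpow_add h, ← Real.rpow_add h, ← Real.rpow_natCast,
    ← Real.rpow_neg h.le]
  norm_num

end Fredkin

theorem mainTheorem2 :
    (∃ c : ℝ, 0 < c ∧ ∀ (s n : ℕ), s ≤ n → ∀ (hΩ : 1 < Fintype.card (Fredkin.DyckPath n s))
      (P : Matrix (Fredkin.DyckPath n s) (Fredkin.DyckPath n s) ℝ)
      (hP : Fredkin.IsFredkinChain P),
      c * s * (n : ℝ) ^ (-(15 / 2 : ℝ)) * Fredkin.minTransition P ≤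
        Fredkin.spectralGap hP.reversible hΩ) ∧
    (∀ s : ℕ, ∃ c : ℝ, 0 < c ∧ ∀ (n : ℕ) (hΩ : 1 < Fintype.card (Fredkin.DyckPath n s))
      (P : Matrix (Fredkin.DyckPath n s) (Fredkin.DyckPath n s) ℝ)
      (hP : Fredkin.IsFredkinChain P),
      c * s * (n : ℝ) ^ (-(15 / 2 : ℝ)) * Fredkin.minTransition P ≤
        Fredkin.spectralGap hP.reversible hΩ) := by
  -- 1/256 cancels the Poincaré constant; what remains is s^2 / n^2 ≤ 1.
  refine ⟨⟨1 / 256, by norm_num, fun s n hsn hΩ P hP => ?_⟩, fun s => ?_⟩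
  · refine Fredkin.mul_minTransition_le_spectralGap hΩ hP (by positivity) ?_
    obtain ⟨-, hn⟩ := Fredkin.pos_of_one_lt_card hΩ
    have hn' : (0 : ℝ) < n := by exact_mod_cast hn
    calc _ = (s : ℝ) ^ 2 * ((n : ℝ) ^ (-(15 / 2 : ℝ)) *
          ((n : ℝ) ^ 4 * (n : ℝ) ^ (3 / 2 : ℝ))) := by ring
      _ = (s : ℝ) ^ 2 * ((n : ℝ) ^ 2)⁻¹ := by rw [Fredkin.rpow_mul_pow_mul_rpow hn]
      _ ≤ (n : ℝ) ^ 2 * ((n : ℝ) ^ 2)⁻¹ := by gcongr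
      _ = 1 := mul_inv_cancel₀ (by positivity)
  · rcases Nat.eq_zero_or_pos s with rfl | hs
    · exact ⟨1, one_pos, fun n hΩ => absurd (Fredkin.pos_of_one_lt_card hΩ).1 (lt_irrefl 0)⟩
    have hs' : (0 : ℝ) < s := by exact_mod_cast hs
    -- One factor s cancels the s of the claim, the other that of the Poincaré constant.
    refine ⟨1 / (256 * s ^ 2), by positivity, fun n hΩ P hP => ?_⟩
    refine Fredkin.mul_minTransition_le_spectralGap hΩ hP (by positivity) ?_
    obtain ⟨-, hn⟩ := Fredkin.pos_of_one_lt_card hΩ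
    have hn' : (1 : ℝ) ≤ n := by exact_mod_cast hn
    calc _ = (n : ℝ) ^ (-(15 / 2 : ℝ)) * ((n : ℝ) ^ 4 * (n : ℝ) ^ (3 / 2 : ℝ)) := by
          field_simp
      _ = ((n : ℝ) ^ 2)⁻¹ := Fredkin.rpow_mul_pow_mul_rpow hn
      _ ≤ 1 := inv_le_one_of_one_le₀ (one_le_pow₀ hn')
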